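/- Let $G$ be a three-dimensional Lie group with a bi-invariant Riemannian metric $\langle\cdot,\cdot\rangle$ and Lie algebra $\mathfrak g$. Vector fields along a curve in $G$ are expressed in left-invariant fields, that is, regarded as $\mathfrak g$-valued functions; with $\dot W$ the ordinary derivative, $D_TW=\dot W+\frac12[T,W]$. For a smooth arc-length parametrized curve $\alpha:I\to G$ on an open interval, with tangent $T$ and curvature $\kappa=\|D_TT\|>0$, let $N=\kappa^{-1}D_TT$, let $B$ be the binormal (so that $T,N,B$ is a differentiable orthonormal frame), and put $\tau=\langle D_TN,B\rangle$, $\tau_G=\frac12\langle[T,N],B\rangle$. Call $\alpha$ a general helix (respectively a slant helix) if $T$ (respectively $N$) makes a constant angle with some left-invariant field $X\neq0$, and non-planar if $\tau-\tau_G$ vanishes nowhere. The binormal indicatrix $\alpha_b$ of $\alpha$ is the curve $s\mapsto B(s)$ in the unit sphere $S^2\subset\mathfrak g$. A spherical helix is a regular curve in $S^2\subset\mathfrak g$ whose tangent makes a constant angle with a fixed direction of $\mathfrak g$. Let $\alpha:I\to G$ and $\tilde\alpha:\tilde I\to G$ be two such curves, with principal normals $N$ and $\tilde N$. They form a Bertrand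 pair if there are a smooth bijection $\varphi:I\to\tilde I$ with nowhere vanishing derivative and a constant $\lambda\neq0$ such that $\tilde\alpha\circ\varphi=\alpha+\lambda N$ and such that $N(s)$ and $\tilde N(\varphi(s))$ are linearly dependent in $\mathfrak g$ for all $s\in I$. Here $\tilde\alpha\circ\varphi=\alpha+\lambda N$ means that one of the following holds: either $\tilde\alpha(\varphi(s))=\alpha(s)\exp(\lambda N(s))$ for all $s$ (so $\tilde\alpha(\varphi(s))$ lies on the principal normal geodesic of $\alpha$ at $s$), or, for all $s$, the velocity of $\tilde\alpha\circ\varphi$ at $s$, left-translated to $\mathfrak g$, equals $T+\lambda\dot N=T+\lambda\left(D_TN-\frac12[T,N]\right)$. Suppose that $(\alpha,\tilde\alpha)$ is a Bertrand pair, that neither curve is a general helix, and that both curves are non-planar. Then $\tilde\alpha$ is a slant helix if and only if the binormal indicatrix $\alpha_b$ of $\alpha$ is a spherical helix. -/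

import Mathlib

open Set
open scoped Manifold ContDiff

noncomputable section

namespace LieCurve

variable {G : Type*} [TopologicalSpace G] [ChartedSpace (EuclideanSpace ℝ (Fin 3)) G] [Group G]

/-- Smooth Riemannian metrics on the three-dimensional Lie group `G`. -/
abbrev Metric (G : Type*) [TopologicalSpace G] [ChartedSpace (EuclideanSpace ℝ (Fin 3)) G]
    [IsManifold (𝓡 3) 1 G] : Type _ :=
  Bundle.ContMDiffRiemannianMetric (𝓡 3) ∞ (EuclideanSpace ℝ (Fin 3))
    (fun x : G => TangentSpace (𝓡 3) x)

/-- A metric is bi-invariant if all left and all right translations preserve it. -/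
def Metric.IsBiinvariant [IsManifold (𝓡 3) 1 G] (m : Metric G) : Prop :=
  (∀ (a x : G) (v w : TangentSpace (𝓡 3) x),
    m.inner (a * x) (mfderiv (𝓡 3) (𝓡 3) (fun y : G => a * y) x v)
      (mfderiv (𝓡 3) (𝓡 3) (fun y : G => a * y) x w) = m.inner x v w) ∧
  (∀ (a x : G) (v w : TangentSpace (𝓡 3) x),
    m.inner (x * a) (mfderiv (𝓡 3) (𝓡 3) (fun y : G => y * a) x v)
      (mfderiv (𝓡 3) (𝓡 3) (fun y : G => y * a) x w) = m.inner x v w)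

/-- The velocity of a curve in `G`, moved to the Lie algebra by left translation:
`(dL_{α(s)⁻¹}) (α'(s))`. For a curve parametrized by arc length this is its unit tangent `T`,
expressed in left-invariant fields. -/
def tangent (α : ℝ → G) (s : ℝ) : GroupLieAlgebra (𝓡 3) G :=
  (mfderiv (𝓡 3) (𝓡 3) (fun y : G => (α s)⁻¹ * y) (α s)
    (mfderiv 𝓘(ℝ, ℝ) (𝓡 3) α s (1 : ℝ)) :)

/-- The covariant derivative `D_{α'} W = Ẇ + ½ [T, W]` of a vector field along `α` for the
Levi-Civita connection of a bi-invariant metric; fields along `α` are expressed in left-invariant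
fields, that is, as functions with values in the Lie algebra. -/
def covDeriv (α : ℝ → G) (W : ℝ → GroupLieAlgebra (𝓡 3) G) (s : ℝ) : GroupLieAlgebra (𝓡 3) G :=
  deriv W s + (1 / 2 : ℝ) • ⁅tangent α s, W s⁆

section Metric

variable [IsManifold (𝓡 3) 1 G] (m : Metric G)

/-- The inner product of the metric on the Lie algebra. -/
def ip (v w : GroupLieAlgebra (𝓡 3) G) : ℝ := m.inner (1 : G) v w

/-- The norm of the metric on the Lie algebra. -/
def nrm (v : GroupLieAlgebra (𝓡 3) G) : ℝ := Real.sqrt (ip m v v)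

/-- The curvature `κ = ‖D_T T‖`. -/
def curvature (α : ℝ → G) (s : ℝ) : ℝ := nrm m (covDeriv α (tangent α) s)

/-- The principal normal `N`, determined by `D_T T = κ N`. -/
def normal (α : ℝ → G) (s : ℝ) : GroupLieAlgebra (𝓡 3) G :=
  (curvature m α s)⁻¹ • covDeriv α (tangent α) s

/-- `α` is a smooth curve on the nonempty open interval `J`, parametrized by arc length (for a
left-invariant metric `‖α'‖ = ‖T‖`), with positive curvature, so that it has a Frenet frame. -/
structure IsFrenetCurve (J : Set ℝ) (α : ℝ → G) : Prop where
  isOpen : IsOpen J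
  ordConnected : J.OrdConnected
  nonempty : J.Nonempty
  smooth : ContMDiffOn 𝓘(ℝ, ℝ) (𝓡 3) ∞ α J
  unit_speed : ∀ s ∈ J, nrm m (tangent α s) = 1
  curvature_pos : ∀ s ∈ J, 0 < curvature m α s

/-- `B` is the binormal field of `α`: it completes `T, N` to an orthonormal frame, differentiably
in `s`. On an interval this is `B = T × N` for one of the two orientations of the Lie algebra. -/
structure IsBinormal (J : Set ℝ) (α : ℝ → G) (B : ℝ → GroupLieAlgebra (𝓡 3) G) : Prop where
  differentiableOn : DifferentiableOn ℝ B J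
  unit : ∀ s ∈ J, nrm m (B s) = 1
  orth_tangent : ∀ s ∈ J, ip m (tangent α s) (B s) = 0
  orth_normal : ∀ s ∈ J, ip m (normal m α s) (B s) = 0

/-- The torsion `τ = ⟨D_T N, B⟩`. -/
def torsion (α : ℝ → G) (B : ℝ → GroupLieAlgebra (𝓡 3) G) (s : ℝ) : ℝ :=
  ip m (covDeriv α (normal m α) s) (B s)

/-- The Lie torsion `τ_G = ½ ⟨[T, N], B⟩`. -/
def lieTorsion (α : ℝ → G) (B : ℝ → GroupLieAlgebra (𝓡 3) G) (s : ℝ) : ℝ :=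
  1 / 2 * ip m ⁅tangent α s, normal m α s⁆ (B s)

/-- The nonzero field `V` along a curve makes a constant angle with a left-invariant field. -/
def HasConstantAngle (J : Set ℝ) (V : ℝ → GroupLieAlgebra (𝓡 3) G) : Prop :=
  ∃ X : GroupLieAlgebra (𝓡 3) G, nrm m X = 1 ∧
    ∃ θ : ℝ, ∀ s ∈ J, ip m (V s) X = nrm m (V s) * Real.cos θ

/-- General helix: the tangent makes a constant angle with a left-invariant field. -/
def IsGeneralHelix (J : Set ℝ) (α : ℝ → G) : Prop := HasConstantAngle m J (tangent α)

/-- Slant helix: the principal normal makes a constant angle with a left-invariant field. -/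
def IsSlantHelix (J : Set ℝ) (α : ℝ → G) : Prop := HasConstantAngle m J (normal m α)

/-- The curve with binormal `B` is (nowhere) planar: `τ - τ_G` has no zero. In the frame
equations `dN/ds = -κ T + (τ - τ_G) B`, `dB/ds = -(τ - τ_G) N`, so this says that `B` is a
regular curve. -/
def IsNonplanar (J : Set ℝ) (α : ℝ → G) (B : ℝ → GroupLieAlgebra (𝓡 3) G) : Prop :=
  ∀ s ∈ J, torsion m α B s - lieTorsion m α B s ≠ 0

/-- A curve `c` in the Lie algebra (a Euclidean 3-space) is a spherical helix: it is a regular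
curve on the unit sphere whose tangent makes a constant angle with a fixed direction. -/
def IsSphericalHelix (J : Set ℝ) (c : ℝ → GroupLieAlgebra (𝓡 3) G) : Prop :=
  DifferentiableOn ℝ c J ∧ (∀ s ∈ J, nrm m (c s) = 1) ∧ (∀ s ∈ J, deriv c s ≠ 0) ∧
    HasConstantAngle m J (deriv c)

/-- `β(s)` is the point at signed distance `l` from `α(s)` on the principal normal line of `α` at
`s`. The normal line is the geodesic of the bi-invariant metric through `α(s)` in the direction
`N(s)`; such geodesics are the curves with constant left-translated velocity, so this says
`β(s) = α(s) exp (l N(s))`. -/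
def IsGeodesicOffset (J : Set ℝ) (α β : ℝ → G) (l : ℝ) : Prop :=
  ∀ s ∈ J, ∃ γ : ℝ → G, ContMDiff 𝓘(ℝ, ℝ) (𝓡 3) ∞ γ ∧ γ 0 = α s ∧
    (∀ t, tangent γ t = normal m α s) ∧ γ l = β s

/-- The infinitesimal form of `β = α + l N`, both sides differentiated in left-invariant fields:
`dβ/ds = T + l (D_T N - ½ [T, N])`. -/
def IsInfinitesimalOffset (J : Set ℝ) (α β : ℝ → G) (l : ℝ) : Prop :=
  ∀ s ∈ J, tangent β s = tangent α s +
    l • (covDeriv α (normal m α) s - (1 / 2 : ℝ) • ⁅tangent α s, normal m α s⁆)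

/-- `(α, β)` is a Bertrand pair, each curve with its own arc length parameter: for a smooth change
of parameter `φ` and a constant `l ≠ 0` one has `β ∘ φ = α + l N`, and the principal normals are
linearly dependent at corresponding points. The formula `α + l N` in a Lie group is
admitted both in its geodesic and in its infinitesimal reading. -/
def IsBertrandPair (J : Set ℝ) (α : ℝ → G) (J' : Set ℝ) (β : ℝ → G) : Prop :=
  ∃ (φ : ℝ → ℝ) (l : ℝ), ContDiffOn ℝ ∞ φ J ∧ BijOn φ J J' ∧ (∀ s ∈ J, deriv φ s ≠ 0) ∧ l ≠ 0 ∧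
    (∀ s ∈ J, ¬ LinearIndependent ℝ ![normal m α s, normal m β (φ s)]) ∧
    (IsGeodesicOffset m J α (β ∘ φ) l ∨ IsInfinitesimalOffset m J α (β ∘ φ) l)

end Metric

end LieCurve

end

/-! In left-invariant fields the bracket terms cancel: `[T, T] = 0` gives `T' = κ N`, and `τ - τ_G =
⟨N', B⟩`. So `T, N, B` obeys the Euclidean Frenet equations in the Lie algebra, in particular `B' =
-(τ - τ_G) N` (`IsFrenetCurve.deriv_binormal`). Non-planarity makes the factor nowhere zero, so on
an interval it has constant sign and `B'` makes a constant angle with `X` exactly when `N` does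
(`hasConstantAngle_congr_smul`). The unit normals of a Bertrand pair are dependent, hence agree up
to a constant sign after reparametrization, so the slant property passes from one curve to the
other.

The norm on `V` serves only for differentiation; the metric enters as a separate bilinear form `b`.
-/

section Calculus

variable {V : Type*} [NormedAddCommGroup V] [NormedSpace ℝ V] (b : V →L[ℝ] V →L[ℝ] ℝ)

theorem IsPreconnected.pos_or_neg_of_ne_zero {J : Set ℝ} (hJ : IsPreconnected J) {f : ℝ → ℝ}
    (hf : ContinuousOn f J) (h0 : ∀ s ∈ J, f s ≠ 0) :
    (∀ s ∈ J, 0 < f s) ∨ (∀ s ∈ J, f s < 0) := by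
  by_contra! h
  obtain ⟨⟨s, hs, hs'⟩, t, ht, ht'⟩ := h
  obtain ⟨r, hr, hr'⟩ := hJ.intermediate_value hs ht hf ⟨hs', ht'⟩
  exact h0 r hr hr'

/-- In dimension three, a vector orthogonal to an orthonormal triple vanishes. -/
theorem eq_zero_of_orthogonal_frame (hdim : Module.finrank ℝ V = 3)
    (hsymm : ∀ v w, b v w = b w v) (hpos : ∀ v, v ≠ 0 → 0 < b v v)
    {t n c x : V} (htt : b t t = 1) (hnn : b n n = 1) (hcc : b c c = 1)
    (htn : b t n = 0) (htc : b t c = 0) (hnc : b n c = 0)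
    (hxt : b x t = 0) (hxn : b x n = 0) (hxc : b x c = 0) : x = 0 := by
  have hli : LinearIndependent ℝ ![t, n, c] := by
    rw [Fintype.linearIndependent_iff]
    intro a ha
    simp only [Fin.sum_univ_three, Matrix.cons_val_zero, Matrix.cons_val_one,
      Matrix.cons_val] at ha
    have key (y : V) : a 0 * b t y + a 1 * b n y + a 2 * b c y = 0 := by
      have := congrArg (fun z => b z y) ha
      simpa using this
    have h0 := key t
    have h1 := key n
    have h2 := key c
    rw [hsymm n t, hsymm c t] at h0
    rw [hsymm c n] at h1
    simp only [htt, hnn, hcc, htn, htc, hnc] at h0 h1 h2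
    intro i
    fin_cases i <;> simp <;> linarith
  have : FiniteDimensional ℝ V := .of_finrank_eq_succ hdim
  have hspan := hli.span_eq_top_of_card_eq_finrank' (by simp [hdim])
  have hx : x ∈ Submodule.span ℝ (range ![t, n, c]) := hspan ▸ Submodule.mem_top
  by_contra hx0
  -- The functional `b x` kills the frame, hence all of `V`, hence `x` itself, against positivity.
  have hker : Submodule.span ℝ (range ![t, n, c]) ≤ LinearMap.ker (b x).toLinearMap := by
    rw [Submodule.span_le]
    rintro _ ⟨i, rfl⟩
    fin_cases i <;> simp [hxt, hxn, hxc]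
  exact (hpos x hx0).ne' (hker hx)

theorem HasDerivAt.bilin {u v : ℝ → V} {u' v' : V} {s : ℝ} (hu : HasDerivAt u u' s)
    (hv : HasDerivAt v v' s) :
    HasDerivAt (fun r => b (u r) (v r)) (b u' (v s) + b (u s) v') s :=
  (b.hasFDerivAt.comp_hasDerivAt s hu).clm_apply hv

theorem ContinuousOn.bilin {J : Set ℝ} {u v : ℝ → V} (hu : ContinuousOn u J)
    (hv : ContinuousOn v J) : ContinuousOn (fun s => b (u s) (v s)) J :=
  (b.continuous.comp_continuousOn hu).clm_apply hv

/-- Differentiating a constant inner product of two fields. -/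
theorem bilin_deriv_add_eq_zero {J : Set ℝ} (hJ : IsOpen J) {u v : ℝ → V}
    {c : ℝ} (hc : ∀ s ∈ J, b (u s) (v s) = c) {s : ℝ} (hs : s ∈ J)
    (hu : DifferentiableAt ℝ u s) (hv : DifferentiableAt ℝ v s) :
    b (deriv u s) (v s) + b (u s) (deriv v s) = 0 := by
  have h := hu.hasDerivAt.bilin b hv.hasDerivAt
  refine h.unique ((hasDerivAt_const s c).congr_of_eventuallyEq ?_)
  filter_upwards [hJ.mem_nhds hs] with r hr using hc r hr

/-- The third frame equation for a differentiable orthonormal frame `t, n, c` with `t' = κ n`. -/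
theorem deriv_binormal_eq (hdim : Module.finrank ℝ V = 3)
    (hsymm : ∀ v w, b v w = b w v) (hpos : ∀ v, v ≠ 0 → 0 < b v v)
    {J : Set ℝ} (hJ : IsOpen J) {t n c : ℝ → V} {κ : ℝ → ℝ}
    (ht : DifferentiableOn ℝ t J) (hn : DifferentiableOn ℝ n J) (hc : DifferentiableOn ℝ c J)
    (hκ : ∀ s ∈ J, κ s ≠ 0) (hdt : ∀ s ∈ J, deriv t s = κ s • n s)
    (htt : ∀ s ∈ J, b (t s) (t s) = 1) (hnn : ∀ s ∈ J, b (n s) (n s) = 1)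
    (hcc : ∀ s ∈ J, b (c s) (c s) = 1) (htc : ∀ s ∈ J, b (t s) (c s) = 0)
    (hnc : ∀ s ∈ J, b (n s) (c s) = 0) {s : ℝ} (hs : s ∈ J) :
    deriv c s = -(b (deriv n s) (c s)) • n s := by
  have dt := ht.differentiableAt (hJ.mem_nhds hs)
  have dn := hn.differentiableAt (hJ.mem_nhds hs)
  have dc := hc.differentiableAt (hJ.mem_nhds hs)
  -- `t` has constant length, so `t' = κ n` is orthogonal to `t`.
  have htn : b (t s) (n s) = 0 := by
    have h := bilin_deriv_add_eq_zero b hJ htt hs dt dt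
    rw [hsymm (deriv t s), hdt s hs, map_smul, smul_eq_mul] at h
    have h' : κ s * b (t s) (n s) = 0 := by linarith
    exact (mul_eq_zero.mp h').resolve_left (hκ s hs)
  have h1 := bilin_deriv_add_eq_zero b hJ htc hs dt dc
  have h2 := bilin_deriv_add_eq_zero b hJ hnc hs dn dc
  have h3 := bilin_deriv_add_eq_zero b hJ hcc hs dc dc
  rw [hdt s hs, map_smul, _root_.smul_apply, hnc s hs, smul_zero, zero_add,
    hsymm] at h1
  rw [hsymm (n s)] at h2
  rw [hsymm (c s)] at h3
  have hnt : b (n s) (t s) = 0 := by rw [hsymm, htn]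
  have hx : deriv c s - -(b (deriv n s) (c s)) • n s = 0 := by
    refine eq_zero_of_orthogonal_frame b hdim hsymm hpos (htt s hs) (hnn s hs) (hcc s hs) htn
      (htc s hs) (hnc s hs) ?_ ?_ ?_ <;>
    simp only [map_sub, map_smul, _root_.sub_apply, _root_.smul_apply,
      smul_eq_mul, hnt, hnn s hs, hnc s hs] <;> linarith
  exact sub_eq_zero.mp hx

/-- The normalized derivative of a smooth curve is smooth where the derivative does not vanish. -/
theorem ContDiffOn.normalized_deriv (hpos : ∀ v, v ≠ 0 → 0 < b v v)
    {J : Set ℝ} (hJ : IsOpen J) {t : ℝ → V} (ht : ContDiffOn ℝ ∞ t J)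
    (h0 : ∀ s ∈ J, deriv t s ≠ 0) :
    ContDiffOn ℝ ∞ (fun s => (Real.sqrt (b (deriv t s) (deriv t s)))⁻¹ • deriv t s) J := by
  have hd : ContDiffOn ℝ ∞ (deriv t) J := ht.deriv_of_isOpen hJ (by simp)
  have hb : ContDiffOn ℝ ∞ (fun s => b (deriv t s) (deriv t s)) J :=
    (b.contDiff.comp_contDiffOn hd).clm_apply hd
  refine ContDiffOn.smul (ContDiffOn.inv (hb.sqrt fun s hs => (hpos _ (h0 s hs)).ne') ?_) hd
  exact fun s hs => (Real.sqrt_pos.mpr (hpos _ (h0 s hs))).ne'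

end Calculus

namespace LieCurve

/-! ### Smoothness of the left logarithmic derivative -/

section Smoothness

variable {E : Type*} [NormedAddCommGroup E] [NormedSpace ℝ E] {H : Type*} [TopologicalSpace H]
  {I : ModelWithCorners ℝ E H} {G : Type*} [TopologicalSpace G] [ChartedSpace H G] [Group G]
  [LieGroup I ∞ G]

/-- With a fixed target point the coordinate change is that of a chart with itself, so smoothness in
tangent coordinates is smoothness of the raw family `φ`. -/
theorem inTangentCoordinates_id_const [IsManifold I 1 G] (p : G) (φ : ℝ → ℝ →L[ℝ] E) (s₀ : ℝ) :
    inTangentCoordinates 𝓘(ℝ, ℝ) I id (fun _ => p) φ s₀ = φ := by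
  funext s
  rw [inTangentCoordinates_eq _ _ _ (by simp [chartAt_self_eq]) (mem_chart_source H p)]
  ext
  simp only [ContinuousLinearMap.comp_apply, tangentBundleCore_coordChange_model_space,
    ContinuousLinearMap.id_apply]
  exact (tangentBundleCore I G).coordChange_self (achart H p) p (mem_chart_source H p) _

/-- The left logarithmic derivative of a smooth curve in a Lie group is smooth. -/
theorem contDiffAt_leftLogDeriv {α : ℝ → G} {s₀ : ℝ} (h : ContMDiffAt 𝓘(ℝ, ℝ) I ∞ α s₀) :
    ContDiffAt ℝ ∞ (fun s : ℝ =>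
      ((mfderiv 𝓘(ℝ, ℝ) I (fun t => (α s)⁻¹ * α t) s : ℝ →L[ℝ] E) 1)) s₀ := by
  have : IsManifold I 1 G := IsManifold.of_le (n := ∞) (by simp)
  have hf : ContMDiffAt (𝓘(ℝ, ℝ).prod 𝓘(ℝ, ℝ)) I ∞
      (Function.uncurry fun s t : ℝ => (α s)⁻¹ * α t) (s₀, s₀) :=
    (ContMDiffAt.inv (ContMDiffAt.comp (s₀, s₀) (by exact h) contMDiffAt_fst)).mul
      (ContMDiffAt.comp (s₀, s₀) (by exact h) contMDiffAt_snd)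
  have hd := ContMDiffAt.mfderiv (m := ∞) (x₀ := s₀) (fun s t : ℝ => (α s)⁻¹ * α t) id hf
    contMDiffAt_id (by simp)
  -- On the diagonal `t = s` the two-parameter map is constantly `1`, so all these derivatives land
  -- in the one tangent space at the identity.
  have hg : (fun s => (α s)⁻¹ * α (id s)) = fun _ => (1 : G) := by
    funext s; exact inv_mul_cancel _
  have hc := inTangentCoordinates_id_const (I := I) (1 : G)
      (fun s => mfderiv 𝓘(ℝ, ℝ) I (fun t => (α s)⁻¹ * α t) s) s₀
  rw [← hg] at hc
  have hd' : ContDiffAt ℝ ∞ (F := ℝ →L[ℝ] E)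
      (fun s => mfderiv 𝓘(ℝ, ℝ) I (fun t => (α s)⁻¹ * α t) s) s₀ := by
    rw [← hc]
    exact hd.contDiffAt
  exact hd'.clm_apply contDiffAt_const

end Smoothness

variable {G : Type*} [TopologicalSpace G] [ChartedSpace (EuclideanSpace ℝ (Fin 3)) G] [Group G]

/-! ### The metric on the Lie algebra and constant angles -/

section
variable [IsManifold (𝓡 3) 1 G] (m : Metric G)

theorem ip_smul_left (c : ℝ) (v w : GroupLieAlgebra (𝓡 3) G) :
    ip m (c • v) w = c * ip m v w := by
  simp [ip]

theorem ip_comm (v w : GroupLieAlgebra (𝓡 3) G) : ip m v w = ip m w v := m.symm _ _ _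

theorem nrm_smul (c : ℝ) (v : GroupLieAlgebra (𝓡 3) G) : nrm m (c • v) = |c| * nrm m v := by
  rw [nrm, nrm, ip_smul_left, ip_comm, ip_smul_left, ← mul_assoc,
    Real.sqrt_mul (mul_self_nonneg c), Real.sqrt_mul_self_eq_abs]

variable {m}

theorem nrm_eq_one_iff {v : GroupLieAlgebra (𝓡 3) G} : nrm m v = 1 ↔ ip m v v = 1 :=
  Real.sqrt_eq_one

/-- The factor `f` has constant sign on `J`; the axis is kept, and a negative sign replaces `θ` by
`π - θ`. -/
theorem HasConstantAngle.of_eq_smul {J : Set ℝ} (hJ : IsPreconnected J)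
    {u v : ℝ → GroupLieAlgebra (𝓡 3) G} {f : ℝ → ℝ} (hf : ContinuousOn f J)
    (h0 : ∀ s ∈ J, f s ≠ 0) (hv : ∀ s ∈ J, v s = f s • u s) (hu : HasConstantAngle m J u) :
    HasConstantAngle m J v := by
  obtain ⟨X, hX, θ, hθ⟩ := hu
  rcases hJ.pos_or_neg_of_ne_zero hf h0 with h | h
  · refine ⟨X, hX, θ, fun s hs => ?_⟩
    rw [hv s hs, ip_smul_left, nrm_smul, hθ s hs, abs_of_pos (h s hs), mul_assoc]
  · refine ⟨X, hX, Real.pi - θ, fun s hs => ?_⟩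
    rw [hv s hs, ip_smul_left, nrm_smul, hθ s hs, abs_of_neg (h s hs), Real.cos_pi_sub]
    ring

theorem hasConstantAngle_congr_smul {J : Set ℝ} (hJ : IsPreconnected J)
    {u v : ℝ → GroupLieAlgebra (𝓡 3) G} {f : ℝ → ℝ} (hf : ContinuousOn f J)
    (h0 : ∀ s ∈ J, f s ≠ 0) (hv : ∀ s ∈ J, v s = f s • u s) :
    HasConstantAngle m J u ↔ HasConstantAngle m J v := by
  refine ⟨.of_eq_smul hJ hf h0 hv, .of_eq_smul hJ (hf.inv₀ h0) (fun s hs => inv_ne_zero (h0 s hs))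
    fun s hs => ?_⟩
  rw [hv s hs, Pi.inv_apply, inv_smul_smul₀ (h0 s hs)]

theorem hasConstantAngle_comp_iff {J J' : Set ℝ} {φ : ℝ → ℝ} (hφ : BijOn φ J J')
    {v : ℝ → GroupLieAlgebra (𝓡 3) G} :
    HasConstantAngle m J (v ∘ φ) ↔ HasConstantAngle m J' v := by
  simp only [HasConstantAngle, ← hφ.image_eq, forall_mem_image, Function.comp_apply]

end

theorem covDeriv_tangent (α : ℝ → G) (s : ℝ) :
    covDeriv α (tangent α) s = deriv (tangent α) s := by
  simp [covDeriv, GroupLieAlgebra.bracket_def]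

/-! ### Frenet frames, slant helices and Bertrand pairs -/

section
variable [LieGroup (𝓡 3) ∞ G]

/-- By the chain rule, translating the velocity by `(α r)⁻¹` is the same as differentiating the
translated curve, which is the left logarithmic derivative. -/
theorem contDiffOn_tangent {J : Set ℝ} (hJ : IsOpen J) {α : ℝ → G}
    (h : ContMDiffOn 𝓘(ℝ, ℝ) (𝓡 3) ∞ α J) :
    ContDiffOn ℝ ∞ (F := EuclideanSpace ℝ (Fin 3)) (tangent α) J := by
  intro s hs
  have hα := fun r (hr : r ∈ J) => (h r hr).contMDiffAt (hJ.mem_nhds hr)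
  refine ((contDiffAt_leftLogDeriv (hα s hs)).congr_of_eventuallyEq ?_).contDiffWithinAt
  filter_upwards [hJ.mem_nhds hs] with r hr
  have hcomp := mfderiv_comp (I := 𝓘(ℝ, ℝ)) (I' := 𝓡 3) (I'' := 𝓡 3) r
    (g := fun y : G => (α r)⁻¹ * y) (f := α)
    ((contMDiff_mul_left (n := ∞)).mdifferentiableAt (by simp))
    ((hα r hr).mdifferentiableAt (by simp))
  exact (congrArg (fun L : ℝ →L[ℝ] EuclideanSpace ℝ (Fin 3) => L 1) hcomp).symm

variable {m : Metric G} {J : Set ℝ} {α : ℝ → G} {B : ℝ → GroupLieAlgebra (𝓡 3) G}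

namespace IsFrenetCurve

theorem isPreconnected (h : IsFrenetCurve m J α) : IsPreconnected J := h.ordConnected.isPreconnected

theorem deriv_tangent_ne_zero (h : IsFrenetCurve m J α) {s : ℝ} (hs : s ∈ J) :
    deriv (tangent α) s ≠ 0 := by
  intro h0
  have := h.curvature_pos s hs
  rw [curvature, covDeriv_tangent, h0] at this
  simp [nrm, ip] at this

theorem deriv_tangent (h : IsFrenetCurve m J α) {s : ℝ} (hs : s ∈ J) :
    deriv (tangent α) s = curvature m α s • normal m α s := by
  rw [normal, smul_inv_smul₀ (h.curvature_pos s hs).ne', covDeriv_tangent]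

theorem nrm_normal (h : IsFrenetCurve m J α) {s : ℝ} (hs : s ∈ J) : nrm m (normal m α s) = 1 := by
  have hk := h.curvature_pos s hs
  rw [normal, nrm_smul, abs_of_pos (inv_pos.mpr hk)]
  exact inv_mul_cancel₀ hk.ne'

theorem contDiffOn_normal (h : IsFrenetCurve m J α) :
    ContDiffOn ℝ ∞ (F := EuclideanSpace ℝ (Fin 3)) (normal m α) J := by
  refine (ContDiffOn.normalized_deriv (V := EuclideanSpace ℝ (Fin 3)) (m.inner 1) (m.pos 1)
    h.isOpen (contDiffOn_tangent h.isOpen h.smooth)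
    fun s hs => h.deriv_tangent_ne_zero hs).congr fun s hs => ?_
  rw [normal, curvature, covDeriv_tangent]
  rfl

end IsFrenetCurve

theorem torsion_sub_lieTorsion (s : ℝ) :
    torsion m α B s - lieTorsion m α B s = ip m (deriv (normal m α) s) (B s) := by
  simp [torsion, lieTorsion, covDeriv, ip]

theorem continuousOn_ip {u v : ℝ → GroupLieAlgebra (𝓡 3) G} (hu : ContinuousOn u J)
    (hv : ContinuousOn v J) : ContinuousOn (fun s => ip m (u s) (v s)) J :=
  ContinuousOn.bilin (V := EuclideanSpace ℝ (Fin 3)) (m.inner 1) hu hv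

theorem IsFrenetCurve.continuousOn_torsion_sub_lieTorsion (h : IsFrenetCurve m J α)
    (hB : IsBinormal m J α B) :
    ContinuousOn (fun s => torsion m α B s - lieTorsion m α B s) J := by
  simp only [torsion_sub_lieTorsion]
  refine continuousOn_ip ?_ hB.differentiableOn.continuousOn
  exact (h.contDiffOn_normal.deriv_of_isOpen (m := ∞) h.isOpen (by simp)).continuousOn

/-- The third Frenet equation `dB/ds = -(τ - τ_G) N`. -/
theorem IsFrenetCurve.deriv_binormal (h : IsFrenetCurve m J α) (hB : IsBinormal m J α B) {s : ℝ}
    (hs : s ∈ J) : deriv B s = -(torsion m α B s - lieTorsion m α B s) • normal m α s := by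
  rw [torsion_sub_lieTorsion]
  exact deriv_binormal_eq (V := EuclideanSpace ℝ (Fin 3)) (m.inner 1) (by simp) (m.symm 1)
    (m.pos 1) h.isOpen ((contDiffOn_tangent h.isOpen h.smooth).differentiableOn (by simp))
    (h.contDiffOn_normal.differentiableOn (by simp)) hB.differentiableOn
    (fun s hs => (h.curvature_pos s hs).ne') (fun s hs => h.deriv_tangent hs)
    (fun s hs => nrm_eq_one_iff.mp (h.unit_speed s hs))
    (fun s hs => nrm_eq_one_iff.mp (h.nrm_normal hs))
    (fun s hs => nrm_eq_one_iff.mp (hB.unit s hs)) hB.orth_tangent hB.orth_normal hs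

/-- A non-planar curve is a slant helix iff its binormal indicatrix is a spherical helix. -/
theorem IsFrenetCurve.isSlantHelix_iff_isSphericalHelix_binormal (h : IsFrenetCurve m J α)
    (hB : IsBinormal m J α B) (hplane : IsNonplanar m J α B) :
    IsSlantHelix m J α ↔ IsSphericalHelix m J B := by
  have hne : ∀ s ∈ J, -(torsion m α B s - lieTorsion m α B s) ≠ 0 :=
    fun s hs => neg_ne_zero.mpr (hplane s hs)
  have hiff : IsSlantHelix m J α ↔ HasConstantAngle m J (deriv B) :=
    hasConstantAngle_congr_smul h.isPreconnected
      (h.continuousOn_torsion_sub_lieTorsion hB).neg hne fun s hs => h.deriv_binormal hB hs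
  -- Regularity of `B` comes for free: a zero of `B'` would force the unit vector `N` to vanish.
  refine hiff.trans ⟨fun hang => ⟨hB.differentiableOn, hB.unit, fun s hs h0 => ?_, hang⟩,
    fun hsph => hsph.2.2.2⟩
  rw [h.deriv_binormal hB hs, smul_eq_zero, or_iff_right (hne s hs)] at h0
  have := h.nrm_normal hs
  rw [h0] at this
  simp [nrm, ip] at this

/-- If the principal normals of two curves are linearly dependent at corresponding points, then
one curve is a slant helix iff the other is. -/
theorem isSlantHelix_iff_of_normals_dependent {J' : Set ℝ} {β : ℝ → G}
    (hα : IsFrenetCurve m J α) (hβ : IsFrenetCurve m J' β) {φ : ℝ → ℝ} (hφ : ContinuousOn φ J)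
    (hbij : BijOn φ J J')
    (hdep : ∀ s ∈ J, ¬ LinearIndependent ℝ ![normal m α s, normal m β (φ s)]) :
    IsSlantHelix m J' β ↔ IsSlantHelix m J α := by
  have hn0 {s : ℝ} (hs : s ∈ J) : normal m α s ≠ 0 := by
    intro h0
    have := hα.nrm_normal hs
    simp [h0, nrm, ip] at this
  -- Pairing with the unit vector `N` identifies the dependence coefficient as an inner product, a
  -- form in which its continuity in `s` is evident.
  have hsmul : ∀ s ∈ J, (normal m β ∘ φ) s =
      ip m (normal m α s) (normal m β (φ s)) • normal m α s := by
    intro s hs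
    have h := hdep s hs
    rw [LinearIndependent.pair_iff' (hn0 hs)] at h
    push Not at h
    obtain ⟨a, ha⟩ := h
    rw [Function.comp_apply, ← ha, ip_comm, ip_smul_left, nrm_eq_one_iff.mp (hα.nrm_normal hs),
      mul_one]
  have hne : ∀ s ∈ J, ip m (normal m α s) (normal m β (φ s)) ≠ 0 := by
    intro s hs h0
    have h := hsmul s hs
    rw [h0, zero_smul, Function.comp_apply] at h
    have := hβ.nrm_normal (hbij.mapsTo hs)
    simp [h, nrm, ip] at this
  rw [IsSlantHelix, IsSlantHelix, ← hasConstantAngle_comp_iff hbij]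
  refine (hasConstantAngle_congr_smul hα.isPreconnected ?_ hne hsmul).symm
  exact continuousOn_ip hα.contDiffOn_normal.continuousOn
    (hβ.contDiffOn_normal.continuousOn.comp hφ hbij.mapsTo)

end

end LieCurve

theorem corollary3p14 {G : Type*} [TopologicalSpace G]
    [ChartedSpace (EuclideanSpace ℝ (Fin 3)) G] [Group G] [LieGroup (𝓡 3) ∞ G]
    (m : LieCurve.Metric G) (hm : m.IsBiinvariant)
    (J J' : Set ℝ) (α α' : ℝ → G) (B B' : ℝ → GroupLieAlgebra (𝓡 3) G)
    (hα : LieCurve.IsFrenetCurve m J α) (hα' : LieCurve.IsFrenetCurve m J' α')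
    (hB : LieCurve.IsBinormal m J α B) (hB' : LieCurve.IsBinormal m J' α' B')
    (hpair : LieCurve.IsBertrandPair m J α J' α')
    (hhelix : ¬ LieCurve.IsGeneralHelix m J α) (hhelix' : ¬ LieCurve.IsGeneralHelix m J' α')
    (hplane : LieCurve.IsNonplanar m J α B) (hplane' : LieCurve.IsNonplanar m J' α' B') :
    LieCurve.IsSlantHelix m J' α' ↔ LieCurve.IsSphericalHelix m J B := by
  obtain ⟨φ, l, hφ, hbij, -, -, hdep, -⟩ := hpair
  exact (LieCurve.isSlantHelix_iff_of_normals_dependent hα hα' hφ.continuousOn hbij hdep).trans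
    (hα.isSlantHelix_iff_isSphericalHelix_binormal hB hplane)
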